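/- Let $m,q,k\ge 1$ be integers and let $\Omega$ be an alphabet with $q$ letters. A cyclic sequence over $\Omega$ is a finite sequence considered up to rotation; each of the rotations is called a linearization of it. A cyclic multi de Bruijn sequence is a cyclic sequence in which every $k$-mer $z\in\Omega^k$ occurs at exactly $m$ starting positions, where occurrences may overlap and are read cyclically (wrapping around the end, more than once if $k$ exceeds the length of the sequence). For $y\in\Omega^k$ let $\mathcal{LC}_y(m,q,k)$ be the set of linearizations of cyclic multi de Bruijn sequences that start with $y$, i.e. in which $y$ occurs (read cyclically) at the first position. Then, for every $y\in\Omega^k$, the set $\mathcal{LC}_y(m,q,k)$ is finite and $$|\mathcal{LC}_y(m,q,k)|=\frac{W(m,q,k)}{q^k},\qquad\text{where}\qquad W(m,q,k)=\left(\frac{(mq)!}{m!^{\,q}}\right)^{q^{k-1}}.$$ -/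

import Mathlib

namespace MultiDeBruijn

variable {Ω : Type*}

/-- The `k`-mer of the linear sequence `s` starting at position `i` and read cyclically
(wrapping around the end, several times if `k` exceeds the length of `s`). -/
def cyclicKmer (s : List Ω) (k : ℕ) (i : Fin s.length) : Fin k → Ω :=
  fun j => s[(i.val + j.val) % s.length]'(Nat.mod_lt _ i.pos)

/-- The number of starting positions in `s` at which the `k`-mer `y` occurs cyclically. -/
def listCount [DecidableEq Ω] {k : ℕ} (y : Fin k → Ω) (s : List Ω) : ℕ :=
  (Finset.univ.filter fun i : Fin s.length => cyclicKmer s k i = y).card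

/-- The number of cyclic occurrences of `y` does not change under rotation. -/
theorem listCount_eq_of_isRotated [DecidableEq Ω] {k : ℕ} (y : Fin k → Ω) {s t : List Ω}
    (h : s ~r t) : listCount y s = listCount y t := by
  obtain ⟨n, rfl⟩ := h
  unfold listCount
  symm
  have hlen : (s.rotate n).length = s.length := List.length_rotate ..
  refine Finset.card_bij
    (fun i _ => ⟨(i.val + n) % s.length, Nat.mod_lt _ (hlen ▸ i.pos)⟩) ?_ ?_ ?_
  · intro i hi
    simp only [Finset.mem_filter, Finset.mem_univ, true_and] at hi ⊢
    rw [← hi]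
    funext j
    simp only [cyclicKmer, List.getElem_rotate, List.length_rotate]
    congr 1
    simp only [Nat.mod_add_mod]
    congr 1
    omega
  · intro i _ i' _ h
    have h1 : i.val + n ≡ i'.val + n [MOD s.length] := by
      simpa [Nat.ModEq] using h
    have h2 := Nat.ModEq.add_right_cancel' n h1
    apply Fin.ext
    exact Nat.ModEq.eq_of_lt_of_lt h2 (hlen ▸ i.isLt) (hlen ▸ i'.isLt)
  · intro j hj
    have hpos : 0 < s.length := j.pos
    have key : ((j.val + (s.length - n % s.length)) % s.length + n) % s.length = j.val := by
      have hn : n % s.length < s.length := Nat.mod_lt _ hpos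
      rw [Nat.mod_add_mod, Nat.add_mod, ← Nat.mod_mod n, ← Nat.add_mod, Nat.mod_mod,
        show j.val + (s.length - n % s.length) + n % s.length = j.val + s.length by omega,
        Nat.add_mod_right, Nat.mod_eq_of_lt j.isLt]
    refine ⟨⟨(j.val + (s.length - n % s.length)) % s.length,
      hlen.symm ▸ Nat.mod_lt _ hpos⟩, ?_, Fin.ext key⟩
    simp only [Finset.mem_filter, Finset.mem_univ, true_and] at hj ⊢
    rw [← hj]
    funext l
    simp only [cyclicKmer, List.getElem_rotate, List.length_rotate]
    congr 1
    conv_rhs => rw [← key]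
    simp only [Nat.mod_add_mod]
    congr 1
    omega

/-- The number of occurrences of the `k`-mer `y` in a cyclic sequence. -/
def cycleCount [DecidableEq Ω] {k : ℕ} (y : Fin k → Ω) (c : Cycle Ω) : ℕ :=
  Quotient.liftOn' c (listCount y) fun _ _ h => listCount_eq_of_isRotated y h

/-- The cyclic multi de Bruijn sequences over `Ω`: every `k`-mer occurs exactly `m` times. -/
def cyclicSeqs (Ω : Type*) [DecidableEq Ω] (m k : ℕ) : Set (Cycle Ω) :=
  {c | ∀ y : Fin k → Ω, cycleCount y c = m}

/-- The linearizations of the cyclic multi de Bruijn sequences. -/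
def linearizedSeqs (Ω : Type*) [DecidableEq Ω] (m k : ℕ) : Set (List Ω) :=
  {s | ∃ c ∈ cyclicSeqs Ω m k, (s : Cycle Ω) = c}

/-- `s` starts with the `k`-mer `y`, i.e. `y` occurs (cyclically) at the first position of `s`.
If `k ≤ s.length` then this says that `y` is a prefix of `s`. -/
def StartsWith {k : ℕ} (s : List Ω) (y : Fin k → Ω) : Prop :=
  ∃ h : 0 < s.length, cyclicKmer s k ⟨0, h⟩ = y

/-- The linearizations of cyclic multi de Bruijn sequences that start with the `k`-mer `y`. -/
def linearizedSeqsFrom [DecidableEq Ω] (m k : ℕ) (y : Fin k → Ω) : Set (List Ω) :=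
  {s | s ∈ linearizedSeqs Ω m k ∧ StartsWith s y}

/-- `W(m,q,k) = ((mq)! / m!^q)^(q^(k-1))`, for `k ≥ 1`. -/
def W (m q k : ℕ) : ℚ :=
  (((m * q).factorial : ℚ) / (m.factorial : ℚ) ^ q) ^ q ^ (k - 1)

end MultiDeBruijn

/-!
Read as the input of the de Bruijn automaton, whose states are the `(k-1)`-mers, a linearization of
a multi de Bruijn sequence is a closed run using each transition exactly `m` times. As in the BEST
theorem, such a run from `r` is the same as a choice, for each state, of a word containing each
letter `m` times (the letters read in that state, in order), subject to the condition that the last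
exits from the states other than `r` form a spanning tree directed to `r`. Choosing all words
independently and uniformly makes the last letters independent and uniform, so by the matrix-tree
theorem the condition holds with probability the determinant of the Laplacian of the random walk on
the automaton, rooted at `r`. The walk is doubly stochastic and forgets its state after `k - 1`
steps, which forces this determinant to be `q ^ -(k - 1)`. Summing over `r` gives `W(m, q, k)`
linearizations. Since a linearization has `m * q ^ k` rotations, of which `m` start with `y`, a
fraction `q ^ -k` of all linearizations starts with `y`.
-/

namespace MultiDeBruijn

section Arrangements

variable {α : Type*}

/-- The words that are arrangements of the multiset of letters `s`. -/
def arrangements (s : Multiset α) : Set (List α) :=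
  {l | (l : Multiset α) = s}

theorem finite_arrangements (s : Multiset α) : (arrangements s).Finite :=
  (Multiset.finite_toSet s.lists).subset fun _ hl => (Multiset.mem_lists_iff s _).2 hl.symm

variable [DecidableEq α]

theorem arrangements_eq_biUnion_erase {s : Multiset α} (hs : s ≠ 0) :
    arrangements s = ⋃ a ∈ s.toFinset, List.cons a '' arrangements (s.erase a) := by
  ext l
  simp only [arrangements, Set.mem_iUnion, Set.mem_image, Set.mem_ofPred_eq, Multiset.mem_toFinset,
    exists_prop]
  constructor
  · rintro rfl
    cases l with
    | nil => exact absurd rfl hs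
    | cons a l => exact ⟨a, by simp, l, by simp, rfl⟩
  · rintro ⟨a, ha, l, hl, rfl⟩
    rw [← Multiset.cons_coe, hl, Multiset.cons_erase ha]

theorem ncard_arrangements_eq_sum_erase {s : Multiset α} (hs : s ≠ 0) :
    (arrangements s).ncard = ∑ a ∈ s.toFinset, (arrangements (s.erase a)).ncard := by
  have hdisj : (s.toFinset : Set α).PairwiseDisjoint
      fun a => List.cons a '' arrangements (s.erase a) := fun a _ b _ hab => by
    rw [Function.onFun, Set.disjoint_left]
    rintro _ ⟨l, -, rfl⟩ ⟨l', -, h⟩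
    exact hab (List.cons.inj h).1.symm
  have h := s.toFinset.finite_toSet.ncard_biUnion (fun _ _ => (finite_arrangements _).image _) hdisj
  rw [finsum_mem_coe_finset] at h
  simpa only [arrangements_eq_biUnion_erase hs, Finset.mem_coe,
    Set.ncard_image_of_injective _ List.cons_injective] using h

theorem ncard_arrangements_mul_prod_factorial {s : Multiset α} {t : Finset α}
    (hst : s.toFinset ⊆ t) :
    (arrangements s).ncard * ∏ a ∈ t, (s.count a).factorial = s.card.factorial := by
  induction hn : s.card generalizing s with
  | zero =>
    have hs : s = 0 := Multiset.card_eq_zero.1 hn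
    have : arrangements (0 : Multiset α) = {[]} := by ext l; simp [arrangements]
    simp [hs, this]
  | succ n ih =>
    have hs : s ≠ 0 := by rintro rfl; simp at hn
    have prod_factorial_eq : ∀ a ∈ s, ∏ b ∈ t, (s.count b).factorial =
        s.count a * ∏ b ∈ t, ((s.erase a).count b).factorial := fun a ha => by
      have hat : a ∈ t := hst (Multiset.mem_toFinset.2 ha)
      rw [← Finset.mul_prod_erase _ _ hat, ← Finset.mul_prod_erase t (fun b => _) hat, ← mul_assoc,
        Multiset.count_erase_self, Nat.mul_factorial_pred (Multiset.count_ne_zero.2 ha)]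
      congr 1
      exact Finset.prod_congr rfl fun b hb => by
        rw [Multiset.count_erase_of_ne (Finset.ne_of_mem_erase hb)]
    calc (arrangements s).ncard * ∏ b ∈ t, (s.count b).factorial
        = ∑ a ∈ s.toFinset, s.count a * n.factorial := by
          rw [ncard_arrangements_eq_sum_erase hs, Finset.sum_mul]
          refine Finset.sum_congr rfl fun a ha => ?_
          rw [Multiset.mem_toFinset] at ha
          rw [prod_factorial_eq a ha, mul_left_comm, ih]
          · exact (Multiset.toFinset_subset.2 (Multiset.erase_subset a s)).trans hst
          · rw [Multiset.card_erase_of_mem ha, hn, Nat.pred_succ]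
      _ = (n + 1).factorial := by
          rw [← Finset.sum_mul, Multiset.toFinset_sum_count_eq, hn, Nat.factorial_succ]

end Arrangements

section EquidistributedWords

variable {Ω : Type*} [DecidableEq Ω]

/-- The words in which each letter of `Ω` occurs exactly `m` times. -/
def equidistributedWords (Ω : Type*) [DecidableEq Ω] (m : ℕ) : Set (List Ω) :=
  {l | ∀ a, l.count a = m}

variable {m : ℕ}

theorem map_mem_equidistributedWords_iff (σ : Equiv.Perm Ω) {l : List Ω} :
    l.map σ ∈ equidistributedWords Ω m ↔ l ∈ equidistributedWords Ω m :=
  (σ.forall_congr_right (q := fun a => (l.map σ).count a = m)).symm.trans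
    (forall_congr' fun a => by rw [List.count_map_of_injective _ _ σ.injective])

theorem ne_nil_of_mem_equidistributedWords [Nonempty Ω] (hm : 1 ≤ m) {l : List Ω}
    (hl : l ∈ equidistributedWords Ω m) : l ≠ [] := by
  rintro rfl
  have := hl (Classical.arbitrary Ω)
  rw [List.count_nil] at this
  omega

variable [Fintype Ω]

theorem equidistributedWords_eq_arrangements (m : ℕ) :
    equidistributedWords Ω m = arrangements (m • (Finset.univ : Finset Ω).val) := by
  ext l
  simp [equidistributedWords, arrangements, Multiset.ext]

omit [Fintype Ω] in
theorem finite_equidistributedWords [Finite Ω] (m : ℕ) : (equidistributedWords Ω m).Finite := by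
  have := Fintype.ofFinite Ω
  exact equidistributedWords_eq_arrangements (Ω := Ω) m ▸ finite_arrangements _

theorem ncard_equidistributedWords_mul_factorial_pow (m : ℕ) :
    (equidistributedWords Ω m).ncard * m.factorial ^ Fintype.card Ω =
      (m * Fintype.card Ω).factorial := by
  have h := ncard_arrangements_mul_prod_factorial
    (Finset.subset_univ (m • (Finset.univ : Finset Ω).val).toFinset)
  simpa [equidistributedWords_eq_arrangements, Multiset.count_eq_one_of_mem] using h

theorem length_eq_of_mem_equidistributedWords {l : List Ω}
    (hl : l ∈ equidistributedWords Ω m) : l.length = m * Fintype.card Ω := by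
  rw [equidistributedWords_eq_arrangements] at hl
  simpa using congrArg Multiset.card hl

theorem countP_of_mem_equidistributedWords (p : Ω → Prop) [DecidablePred p] {l : List Ω}
    (hl : l ∈ equidistributedWords Ω m) :
    l.countP p = m * (Finset.univ.filter p).card := by
  rw [equidistributedWords_eq_arrangements] at hl
  rw [← Multiset.coe_countP, show (l : Multiset Ω) = _ from hl, Multiset.countP_nsmul,
    Multiset.countP_eq_card_filter]
  rfl

omit [Fintype Ω] in
instance [Finite Ω] : Nonempty (equidistributedWords Ω m) := by
  have := Fintype.ofFinite Ω
  refine Set.Nonempty.to_subtype (Set.nonempty_of_ncard_ne_zero fun h => ?_)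
  have := ncard_equidistributedWords_mul_factorial_pow (Ω := Ω) m
  rw [h, zero_mul] at this
  exact Nat.factorial_ne_zero _ this.symm

omit [Fintype Ω] in
instance [Finite Ω] : Finite (equidistributedWords Ω m) :=
  (finite_equidistributedWords m).to_subtype

omit [Fintype Ω] in
/-- The last letter of an equidistributed word. -/
def lastLetter [Nonempty Ω] (hm : 1 ≤ m) (l : equidistributedWords Ω m) : Ω :=
  l.1.getLast (ne_nil_of_mem_equidistributedWords hm l.2)

omit [Fintype Ω] in
theorem card_lastLetter_eq [Nonempty Ω] (hm : 1 ≤ m) (a b : Ω) :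
    Nat.card {l // lastLetter hm l = a} = Nat.card {l // lastLetter hm l = b} := by
  let e : Equiv.Perm (equidistributedWords Ω m) :=
    (Equiv.listEquivOfEquiv (Equiv.swap a b)).subtypeEquiv fun l =>
      (map_mem_equidistributedWords_iff (Equiv.swap a b)).symm
  have lastLetter_e : ∀ l, lastLetter hm (e l) = Equiv.swap a b (lastLetter hm l) := fun l =>
    List.getLast_map ..
  exact Nat.card_congr (e.subtypeEquiv fun l => by
    rw [lastLetter_e, Equiv.swap_apply_eq_iff, Equiv.swap_apply_right])

end EquidistributedWords

section Stacks

variable {V Ω : Type*} [DecidableEq V]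

/-- The family of stacks `τ` with the letter `a` put on top of the stack of `v`. -/
def push (τ : V → List Ω) (v : V) (a : Ω) : V → List Ω :=
  Function.update τ v (a :: τ v)

theorem push_apply (τ : V → List Ω) (v : V) (a : Ω) (u : V) :
    push τ v a u = if u = v then a :: τ u else τ u := by
  rcases eq_or_ne u v with rfl | h
  · simp [push]
  · simp [push, h]

theorem length_push (τ : V → List Ω) (v : V) (a : Ω) (u : V) :
    (push τ v a u).length = (τ u).length + if u = v then 1 else 0 := by
  rw [push_apply]
  split_ifs <;> simp

theorem push_inj {τ τ' : V → List Ω} {v : V} {a a' : Ω} :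
    push τ v a = push τ' v a' ↔ τ = τ' ∧ a = a' := by
  refine ⟨fun h => ?_, fun ⟨hτ, ha⟩ => by rw [hτ, ha]⟩
  have hv := congrFun h v
  rw [push_apply, push_apply, if_pos rfl, if_pos rfl] at hv
  refine ⟨funext fun u => ?_, (List.cons.inj hv).1⟩
  have hu := congrFun h u
  rw [push_apply, push_apply] at hu
  split_ifs at hu
  exacts [(List.cons.inj hu).2, hu]

theorem exists_push_eq {τ : V → List Ω} {v : V} (h : τ v ≠ []) : ∃ τ' a, push τ' v a = τ := by
  obtain ⟨a, l, hal⟩ := List.exists_cons_of_ne_nil h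
  exact ⟨Function.update τ v l, a, by simp [push, ← hal]⟩

variable (δ : V → Ω → V)

/-- The stacks of letters that the automaton `δ` reads in each of its states when it reads a word
from the state `v`, first letter on top. -/
def exitStacks : V → List Ω → V → List Ω
  | _, [] => fun _ => []
  | v, a :: s => push (exitStacks (δ v a) s) v a

theorem exitStacks_cons (v : V) (a : Ω) (s : List Ω) :
    exitStacks δ v (a :: s) = push (exitStacks δ (δ v a) s) v a :=
  rfl

theorem exitStacks_injective (v : V) : Function.Injective (exitStacks δ v) := by
  intro s t h
  induction s generalizing v t with
  | nil =>
    cases t with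
    | nil => rfl
    | cons b t => simpa [exitStacks, push] using congrFun h v
  | cons a s ih =>
    cases t with
    | nil => simpa [exitStacks, push] using congrFun h v
    | cons b t =>
      obtain ⟨htail, rfl⟩ := push_inj.1 h
      rw [ih _ htail]

theorem count_exitStacks [DecidableEq Ω] (v : V) (s : List Ω) (u : V) (a : Ω) :
    (exitStacks δ v s u).count a =
      (Finset.univ.filter fun i : Fin s.length =>
        (s.take i).foldl δ v = u ∧ s[i.val] = a).card := by
  induction s generalizing v with
  | nil => simp [exitStacks]
  | cons b s ih =>
    have card_cons : (Finset.univ.filter fun i : Fin (b :: s).length =>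
        ((b :: s).take i).foldl δ v = u ∧ (b :: s)[i.val] = a).card =
        (if v = u ∧ b = a then 1 else 0) + (exitStacks δ (δ v b) s u).count a := by
      rw [ih, Finset.card_filter, Finset.card_filter]
      exact Fin.sum_univ_succ _
    rw [card_cons, exitStacks_cons, push_apply]
    rcases eq_or_ne u v with rfl | huv
    · simp [List.count_cons, add_comm]
    · simp [huv, huv.symm]

end Stacks

section DirectedStacks

variable {V Ω : Type*} (δ : V → Ω → V)

/-- The relation `w = δ u a`, where `a` is the letter at the bottom of the stack of `u`: when the
stacks record a run of `δ`, this is the transition of the last exit from `u`. -/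
def LastExit (τ : V → List Ω) (u w : V) : Prop :=
  ∃ a ∈ (τ u).getLast?, δ u a = w

/-- From each state with a nonempty stack, the last exits lead to `e`. -/
def IsDirectedTo (τ : V → List Ω) (e : V) : Prop :=
  ∀ u, τ u ≠ [] → Relation.ReflTransGen (LastExit δ τ) u e

variable {δ}

theorem LastExit.ne_nil {τ : V → List Ω} {u w : V} (h : LastExit δ τ u w) : τ u ≠ [] := by
  rintro hu
  simp [LastExit, hu] at h

variable [DecidableEq V]

theorem lastExit_push_iff {τ : V → List Ω} {v : V} {a : Ω} {u w : V} (h : τ u ≠ []) :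
    LastExit δ (push τ v a) u w ↔ LastExit δ τ u w := by
  rw [LastExit, LastExit, push_apply]
  split_ifs
  · simp [List.getLast?_cons, List.getLast?_eq_some_getLast h]
  · rfl

theorem LastExit.push {τ : V → List Ω} {u w : V} (h : LastExit δ τ u w) (v : V) (a : Ω) :
    LastExit δ (push τ v a) u w :=
  (lastExit_push_iff h.ne_nil).2 h

variable (δ) [Fintype V]

/-- The number of letters on the stacks `τ` that lead to the state `u`. -/
def inflow (τ : V → List Ω) (u : V) : ℕ :=
  ∑ w, (τ w).countP fun a => δ w a = u

/-- The flow condition satisfied by the stacks of a run from `v` to `e`: each state is entered as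
often as it is left, once the start at `v` and the end at `e` are taken into account. -/
def IsBalanced (τ : V → List Ω) (v e : V) : Prop :=
  ∀ u, inflow δ τ u + (if u = v then 1 else 0) = (τ u).length + if u = e then 1 else 0

variable {δ}

theorem LastExit.inflow_pos {τ : V → List Ω} {u w : V} (h : LastExit δ τ u w) :
    0 < inflow δ τ w := by
  obtain ⟨a, ha, hw⟩ := h
  refine Finset.sum_pos' (fun _ _ => Nat.zero_le _) ⟨u, Finset.mem_univ u, ?_⟩
  exact List.countP_pos_iff.2 ⟨a, List.mem_of_getLast? ha, by simpa using hw⟩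

theorem inflow_push (τ : V → List Ω) (v : V) (a : Ω) (u : V) :
    inflow δ (push τ v a) u = inflow δ τ u + if u = δ v a then 1 else 0 := by
  have countP_push : ∀ w, (push τ v a w).countP (fun b => δ w b = u) =
      (τ w).countP (fun b => δ w b = u) + if w = v then (if u = δ v a then 1 else 0) else 0 :=
    fun w => by
      simp only [push_apply, @eq_comm _ u (δ v a)]
      split_ifs <;> simp_all
  simp only [inflow, countP_push, Finset.sum_add_distrib, Finset.sum_ite_eq', Finset.mem_univ,
    if_true]

theorem isBalanced_push_iff {τ : V → List Ω} {v e : V} {a : Ω} :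
    IsBalanced δ (push τ v a) v e ↔ IsBalanced δ τ (δ v a) e := by
  refine forall_congr' fun u => ?_
  rw [inflow_push, length_push]
  omega

theorem isBalanced_nil (v : V) : IsBalanced δ (fun _ => []) v v := fun u => by
  simp [inflow]

theorem IsBalanced.ne_nil {τ : V → List Ω} {v e u : V} (h : IsBalanced δ τ v e) (hue : u ≠ e)
    (hu : u = v ∨ 0 < inflow δ τ u) : τ u ≠ [] := by
  intro hnil
  have hbal := h u
  rw [hnil, List.length_nil, if_neg hue] at hbal
  rcases hu with rfl | hu
  · simp at hbal
  · omega

theorem IsBalanced.reflTransGen_of_push {τ : V → List Ω} {v v' e u : V} {a : Ω}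
    (hτ : IsBalanced δ τ v' e) (h : Relation.ReflTransGen (LastExit δ (push τ v a)) u e)
    (hu : τ u ≠ []) : Relation.ReflTransGen (LastExit δ τ) u e := by
  induction h using Relation.ReflTransGen.head_induction_on with
  | refl => exact .refl
  | @head u w huw _ ih =>
    have hstep : LastExit δ τ u w := (lastExit_push_iff hu).1 huw
    rcases eq_or_ne w e with rfl | hwe
    · exact .single hstep
    · exact .head hstep (ih (hτ.ne_nil hwe (.inr hstep.inflow_pos)))

theorem isDirectedTo_push_iff {τ : V → List Ω} {v e : V} {a : Ω}
    (hτ : IsBalanced δ τ (δ v a) e) :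
    IsDirectedTo δ (push τ v a) e ↔ IsDirectedTo δ τ e := by
  constructor
  · intro h u hu
    refine hτ.reflTransGen_of_push (h u fun hnil => hu ?_) hu
    have := length_push τ v a u
    rw [hnil, List.length_nil] at this
    exact List.length_eq_zero_iff.1 (by omega)
  · intro h
    have hpush : ∀ u, τ u ≠ [] → Relation.ReflTransGen (LastExit δ (push τ v a)) u e :=
      fun u hu => Relation.ReflTransGen.mono (fun _ _ hw => hw.push v a) _ _ (h u hu)
    intro u hu
    by_cases hnil : τ u = []
    · obtain rfl : u = v := by
        by_contra huv
        exact hu (by rw [push_apply, if_neg huv, hnil])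
      have hexit : LastExit δ (push τ u a) u (δ u a) := ⟨a, by simp [push_apply, hnil], rfl⟩
      rcases eq_or_ne (δ u a) e with he | he
      · exact he ▸ .single hexit
      · exact .head hexit (hpush _ (hτ.ne_nil he (.inl rfl)))
    · exact hpush u hnil

theorem IsDirectedTo.eq_nil {τ : V → List Ω} {v e : V} (hdir : IsDirectedTo δ τ e)
    (hbal : IsBalanced δ τ v e) (hv : τ v = []) : v = e ∧ τ = fun _ => [] := by
  obtain rfl : v = e := by
    by_contra hve
    exact hbal.ne_nil hve (.inl rfl) hv
  refine ⟨rfl, funext fun u => ?_⟩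
  by_contra hu
  rcases Relation.ReflTransGen.cases_tail (hdir u hu) with rfl | ⟨w, -, hwv⟩
  · exact hu hv
  · have hpos := hwv.inflow_pos
    have := hbal v
    rw [hv, List.length_nil] at this
    omega

/-- Reading the top of the stack of the current state and moving on recovers the word. The stacks
can only run empty before all letters are read if they fail to be directed to `e`. -/
theorem exists_exitStacks_eq_iff {τ : V → List Ω} {v e : V} :
    (∃ s, exitStacks δ v s = τ ∧ s.foldl δ v = e) ↔
      IsBalanced δ τ v e ∧ IsDirectedTo δ τ e := by
  constructor
  · rintro ⟨s, rfl, rfl⟩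
    induction s generalizing v with
    | nil => exact ⟨isBalanced_nil v, fun _ h => absurd rfl h⟩
    | cons a s ih =>
      obtain ⟨hbal, hdir⟩ := @ih (δ v a)
      exact ⟨isBalanced_push_iff.2 hbal, (isDirectedTo_push_iff hbal).2 hdir⟩
  · rintro ⟨hbal, hdir⟩
    induction hN : ∑ u, (τ u).length generalizing τ v with
    | zero =>
      have hv : τ v = [] :=
        List.length_eq_zero_iff.1 (Finset.sum_eq_zero_iff.1 hN v (Finset.mem_univ v))
      obtain ⟨rfl, rfl⟩ := hdir.eq_nil hbal hv
      exact ⟨[], rfl, rfl⟩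
    | succ N ih =>
      have hv : τ v ≠ [] := fun hv => by simp [(hdir.eq_nil hbal hv).2] at hN
      obtain ⟨τ, a, rfl⟩ := exists_push_eq hv
      rw [isBalanced_push_iff] at hbal
      rw [isDirectedTo_push_iff hbal] at hdir
      simp only [length_push, Finset.sum_add_distrib, Finset.sum_ite_eq', Finset.mem_univ,
        if_true, Nat.add_right_cancel_iff] at hN
      obtain ⟨s, rfl, hs⟩ := ih hbal hdir hN
      exact ⟨a :: s, rfl, hs⟩

end DirectedStacks

section Determinants

open Matrix

variable {V R : Type*} [Fintype V] [DecidableEq V] [CommRing R]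

theorem det_one_sub_eq_one_of_isNilpotent [IsReduced R] {A : Matrix V V R} (h : IsNilpotent A) :
    (1 - A).det = 1 := by
  have hcharpoly := (isNilpotent_charpoly_sub_pow_of_isNilpotent h).map (Polynomial.evalRingHom 1)
  simpa [eval_charpoly, sub_eq_zero] using hcharpoly.eq_zero

/-- The Laplacian of the digraph with edge weights `P`, with the row of the root `r` replaced by
a row of the identity matrix. Its determinant is the weighted count of spanning trees directed
to `r` when the rows of `P` sum to `1`. -/
def rootedLaplacian (P : Matrix V V R) (r : V) : Matrix V V R :=
  1 - P.updateRow r 0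

omit [Fintype V] in
theorem rootedLaplacian_eq_updateRow (P : Matrix V V R) (r : V) :
    rootedLaplacian P r = (1 - P).updateRow r (Pi.single r 1) := by
  ext u w
  rcases eq_or_ne u r with rfl | hu
  · simp [rootedLaplacian, one_apply, Pi.single_apply, eq_comm]
  · simp [rootedLaplacian, updateRow_ne hu]

/-- The edges `u → g u` for `u ≠ r` form a spanning tree directed to `r`. -/
def IsTreeToward (g : V → V) (r : V) : Prop :=
  ∀ u, Relation.ReflTransGen (fun u w => g u = w) u r

theorem updateRow_zero_mulVec_apply (g : V → V) (r : V) (x : V → R) (u : V) :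
    (((1 : Matrix V V R).submatrix g id).updateRow r 0 *ᵥ x) u = if u = r then 0 else x (g u) := by
  rcases eq_or_ne u r with rfl | hu
  · simp [mulVec]
  · simp [mulVec, hu, dotProduct, Matrix.one_apply]

theorem isNilpotent_updateRow_zero_of_isTreeToward {g : V → V} {r : V} (h : IsTreeToward g r) :
    IsNilpotent (((1 : Matrix V V R).submatrix g id).updateRow r 0) := by
  set A : Matrix V V R := ((1 : Matrix V V R).submatrix g id).updateRow r 0
  have pow_succ_apply : ∀ j x u, (A ^ (j + 1) *ᵥ x) u = if u = r then 0 else (A ^ j *ᵥ x) (g u) :=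
    fun j x u => by
      rw [pow_succ', ← mulVec_mulVec, updateRow_zero_mulVec_apply]
  have eventually_zero : ∀ u, ∃ i, ∀ j, i ≤ j → ∀ x, (A ^ j *ᵥ x) u = 0 := fun u => by
    induction h u using Relation.ReflTransGen.head_induction_on with
    | refl =>
      refine ⟨1, fun j hj x => ?_⟩
      obtain ⟨j, rfl⟩ := Nat.exists_eq_add_of_le' hj
      rw [pow_succ_apply, if_pos rfl]
    | @head u w huw _ ih =>
      obtain ⟨i, hi⟩ := ih
      refine ⟨i + 1, fun j hj x => ?_⟩
      obtain ⟨j, rfl⟩ := Nat.exists_eq_add_of_le' (Nat.le_of_add_left_le hj)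
      rw [pow_succ_apply, huw, hi j (by omega), ite_self]
  choose d hd using eventually_zero
  refine ⟨∑ u, d u, Matrix.ext fun u w => ?_⟩
  have hu : d u ≤ ∑ u, d u := Finset.single_le_sum (fun _ _ => Nat.zero_le _) (Finset.mem_univ u)
  simpa using hd u _ hu (Pi.single w 1)

open Classical in
theorem det_rootedLaplacian_submatrix_one [IsDomain R] (g : V → V) (r : V) :
    (rootedLaplacian ((1 : Matrix V V R).submatrix g id) r).det =
      if IsTreeToward g r then 1 else 0 := by
  split_ifs with h
  · exact det_one_sub_eq_one_of_isNilpotent (isNilpotent_updateRow_zero_of_isTreeToward h)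
  -- Otherwise the indicator of the states that do not lead to `r` is in the kernel.
  let LeadsToRoot (u : V) : Prop := Relation.ReflTransGen (fun u w => g u = w) u r
  obtain ⟨u₀, hu₀⟩ : ∃ u, ¬ LeadsToRoot u := not_forall.1 h
  refine exists_mulVec_eq_zero_iff.1 ⟨fun u => if LeadsToRoot u then 0 else 1,
    fun h0 => by simpa [hu₀] using congrFun h0 u₀, funext fun u => ?_⟩
  rw [rootedLaplacian, sub_mulVec, one_mulVec, Pi.sub_apply, updateRow_zero_mulVec_apply]
  rcases eq_or_ne u r with rfl | hu
  · simp [LeadsToRoot, Relation.ReflTransGen.refl]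
  · have leadsToRoot_iff : LeadsToRoot u ↔ LeadsToRoot (g u) := by
      refine ⟨fun hr => ?_, fun hr => hr.head rfl⟩
      obtain rfl | ⟨w, rfl, hw⟩ := hr.cases_head
      exacts [absurd rfl hu, hw]
    simp [hu, leadsToRoot_iff]

theorem one_vecMul_pow {P : Matrix V V R} (h : 1 ᵥ* P = 1) (n : ℕ) : 1 ᵥ* P ^ n = 1 := by
  induction n with
  | zero => simp
  | succ n ih => rw [pow_succ, ← vecMul_vecMul, ih, h]

theorem card_mul_pow_apply {P : Matrix V V R} {n : ℕ} (hcol : 1 ᵥ* P = 1)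
    (hrow : ∀ u u' w, (P ^ n) u w = (P ^ n) u' w) (u w : V) : Fintype.card V * (P ^ n) u w = 1 := by
  have hsum := congrFun (one_vecMul_pow hcol n) w
  simpa [vecMul, dotProduct, fun v => hrow v u w] using hsum

/-- The matrix `P - e_r 1ᵀ` is nilpotent because `1ᵀ` annihilates it from the left. -/
theorem det_one_sub_add_vecMulVec [IsReduced R] {P : Matrix V V R} {n : ℕ} (r : V)
    (hcol : 1 ᵥ* P = 1) (hrow : ∀ u u' w, (P ^ n) u w = (P ^ n) u' w) :
    (1 - P + vecMulVec (Pi.single r 1) 1).det = 1 := by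
  set B : Matrix V V R := P - vecMulVec (Pi.single r 1) 1 with hB
  have one_vecMul_B : 1 ᵥ* B = 0 := by
    rw [hB, vecMul_sub, hcol, vecMul_vecMulVec]
    simp
  have pow_succ_eq : ∀ j, B ^ (j + 1) = P ^ j * B := fun j => by
    induction j with
    | zero => simp
    | succ j ih =>
      rw [pow_succ', ih]
      nth_rw 1 [hB]
      rw [sub_mul, ← mul_assoc, ← pow_succ', vecMulVec_mul, ← vecMul_vecMul, one_vecMul_pow hcol,
        one_vecMul_B, vecMulVec_zero, sub_zero]
  have hnil : B ^ (n + 1) = 0 := by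
    rw [pow_succ_eq]
    have hcard : IsUnit (Fintype.card V : R) :=
      IsUnit.of_mul_eq_one _ (card_mul_pow_apply hcol hrow r r)
    refine Matrix.ext fun u w => hcard.mul_right_eq_zero.1 ?_
    rw [mul_apply, Finset.mul_sum]
    simpa [← mul_assoc, card_mul_pow_apply hcol hrow, vecMul, dotProduct] using
      congrFun one_vecMul_B w
  have hsub : 1 - P + vecMulVec (Pi.single r 1) 1 = 1 - B := by
    rw [hB, sub_sub_eq_add_sub, sub_add_eq_add_sub]
  rw [hsub, det_one_sub_eq_one_of_isNilpotent ⟨n + 1, hnil⟩]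

theorem card_mul_det_rootedLaplacian [IsDomain R] {P : Matrix V V R} {n : ℕ} (r : V)
    (hcol : 1 ᵥ* P = 1) (hrow : ∀ u u' w, (P ^ n) u w = (P ^ n) u' w) :
    Fintype.card V * (rootedLaplacian P r).det = 1 := by
  have hdet : (1 - P).det = 0 :=
    exists_vecMul_eq_zero_iff.1 ⟨1, fun h => one_ne_zero (congrFun h r), by
      rw [vecMul_sub, vecMul_one, hcol, sub_self]⟩
  have pow_mul_adjugate : ∀ j, P ^ j * (1 - P).adjugate = (1 - P).adjugate := fun j => by
    induction j with
    | zero => simp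
    | succ j ih =>
      have h := mul_adjugate (1 - P)
      rw [hdet, zero_smul, sub_mul, one_mul, sub_eq_zero] at h
      rw [pow_succ, mul_assoc, ← h, ih]
  have adjugate_apply_eq : ∀ w, (1 - P).adjugate w r = (rootedLaplacian P r).det := fun w => by
    rw [rootedLaplacian_eq_updateRow, ← adjugate_apply, ← pow_mul_adjugate n,
      mul_apply, mul_apply]
    exact Finset.sum_congr rfl fun v _ => by rw [hrow w r v]
  have hsplit : 1 - P + vecMulVec (Pi.single r 1) 1 = (1 - P).updateRow r ((1 - P) r + 1) := by
    ext u w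
    rcases eq_or_ne u r with rfl | hu
    · simp
    · simp [hu]
  have h := det_one_sub_add_vecMulVec r hcol hrow
  rw [hsplit, det_updateRow_add, updateRow_eq_self, hdet, zero_add, ← cramer_transpose_apply,
    cramer_eq_adjugate_mulVec, ← adjugate_transpose] at h
  simpa [mulVec, dotProduct, adjugate_apply_eq] using h

end Determinants

section Automata

variable {V Ω X : Type*}

/-- The automaton `δ` has constant in-degree: each state is entered by as many transitions as there
are letters. -/
def IsRegular [Fintype V] [DecidableEq V] [Fintype Ω] (δ : V → Ω → V) : Prop :=
  ∀ w, (Finset.univ.filter fun p : V × Ω => δ p.1 p.2 = w).card = Fintype.card Ω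

/-- The automaton `δ` is `n`-definite: the last `n` letters it has read determine its state. -/
def IsDefinite (δ : V → Ω → V) (n : ℕ) : Prop :=
  ∀ s : List Ω, n ≤ s.length → ∀ u u', s.foldl δ u = s.foldl δ u'

theorem IsDefinite.eq_of_foldl_eq {δ : V → Ω → V} {n : ℕ} (h : IsDefinite δ n) {s : List Ω}
    (hs : s ≠ []) {u u' : V} (hu : s.foldl δ u = u) (hu' : s.foldl δ u' = u') : u = u' := by
  have foldl_replicate {v : V} (hv : s.foldl δ v = v) (j : ℕ) :
      (List.replicate j s).flatten.foldl δ v = v := by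
    induction j with
    | zero => rfl
    | succ j ih => rw [List.replicate_succ, List.flatten_cons, List.foldl_append, hv, ih]
  have hlen : n ≤ (List.replicate n s).flatten.length := by
    simpa using Nat.le_mul_of_pos_right n (List.length_pos_iff.2 hs)
  rw [← foldl_replicate hu n, h _ hlen u u', foldl_replicate hu' n]

theorem IsDefinite.comp {δ : V → Ω → V} {n : ℕ} (h : IsDefinite δ n) (g : X → Ω) :
    IsDefinite (fun u x => δ u (g x)) n := fun s hs u u' => by
  simpa only [List.foldl_map] using h (s.map g) (by rwa [List.length_map]) u u'

variable [Fintype V] [DecidableEq V] [Fintype Ω] [Fintype X]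

theorem IsRegular.comp [DecidableEq Ω] {δ : V → Ω → V} (h : IsRegular δ) {g : X → Ω} {c : ℕ}
    (hg : ∀ a, (Finset.univ.filter fun x => g x = a).card = c) :
    IsRegular fun u x => δ u (g x) := fun w => by
  have sum_comp : ∀ F : Ω → ℕ, ∑ x, F (g x) = c * ∑ a, F a := fun F => by
    simp [← Finset.sum_fiberwise' Finset.univ g F, hg, Finset.mul_sum]
  have hw := h w
  have hX := sum_comp 1
  simp only [Finset.card_filter, Fintype.sum_prod_type] at hw ⊢
  simp only [fun u => sum_comp fun a => if δ u a = w then 1 else 0, ← Finset.mul_sum, hw]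
  simpa using hX.symm

end Automata

section TreeCount

open Matrix

variable {V Ω : Type*} [Fintype V] [DecidableEq V] [Fintype Ω] (δ : V → Ω → V)

/-- The transition matrix of the Markov chain that feeds uniformly random letters to `δ`. -/
def transitionMatrix : Matrix V V ℚ :=
  of fun u w => (Finset.univ.filter fun a => δ u a = w).card / Fintype.card Ω

theorem transitionMatrix_mulVec_apply (x : V → ℚ) (u : V) :
    (transitionMatrix δ *ᵥ x) u = (∑ a, x (δ u a)) / Fintype.card Ω := by
  simp only [transitionMatrix, mulVec, dotProduct, of_apply, Finset.natCast_card_filter,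
    Finset.sum_div, Finset.sum_mul, div_mul_eq_mul_div]
  rw [Finset.sum_comm]
  simp [← Finset.sum_div]

variable {δ}

theorem one_vecMul_transitionMatrix [Nonempty Ω] (h : IsRegular δ) :
    1 ᵥ* transitionMatrix δ = 1 := by
  funext w
  have hw : ∑ u, (Finset.univ.filter fun a => δ u a = w).card = Fintype.card Ω := by
    rw [← h w]
    simp only [Finset.card_filter, Fintype.sum_prod_type]
  simp [transitionMatrix, vecMul, dotProduct, ← Finset.sum_div, ← Nat.cast_sum, hw]

theorem transitionMatrix_pow_mulVec_apply_eq {j : ℕ} {u u' : V} (x : V → ℚ)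
    (h : ∀ s : List Ω, s.length = j → s.foldl δ u = s.foldl δ u') :
    (transitionMatrix δ ^ j *ᵥ x) u = (transitionMatrix δ ^ j *ᵥ x) u' := by
  induction j generalizing u u' with
  | zero => rw [show u = u' from h [] rfl]
  | succ j ih =>
    rw [pow_succ', ← mulVec_mulVec, transitionMatrix_mulVec_apply, transitionMatrix_mulVec_apply]
    congr 1
    exact Finset.sum_congr rfl fun a _ => ih fun s hs => h (a :: s) (by simp [hs])

theorem card_mul_det_rootedLaplacian_transitionMatrix [Nonempty Ω] (hreg : IsRegular δ) {n : ℕ}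
    (hdef : IsDefinite δ n) (r : V) :
    Fintype.card V * (rootedLaplacian (transitionMatrix δ) r).det = 1 :=
  card_mul_det_rootedLaplacian r (one_vecMul_transitionMatrix hreg) fun u u' w => by
    simpa using transitionMatrix_pow_mulVec_apply_eq (Pi.single w 1)
      fun s hs => hdef s hs.ge u u'

variable (δ) in
theorem sum_det_rootedLaplacian [Nonempty Ω] (r : V) :
    ∑ f : V → Ω, (rootedLaplacian ((1 : Matrix V V ℚ).submatrix (fun u => δ u (f u)) id) r).det =
      Fintype.card Ω ^ Fintype.card V * (rootedLaplacian (transitionMatrix δ) r).det := by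
  classical
  let row (u : V) (a : Ω) : V → ℚ :=
    rootedLaplacian ((1 : Matrix V V ℚ).submatrix (fun u => δ u a) id) r u
  have row_eq : ∀ f : V → Ω, (fun u => row u (f u)) =
      rootedLaplacian ((1 : Matrix V V ℚ).submatrix (fun u => δ u (f u)) id) r := fun f => by
    ext u w
    rcases eq_or_ne u r with rfl | hu
    · simp [row, rootedLaplacian]
    · simp [row, rootedLaplacian, hu]
  have sum_row : (fun u => ∑ a, row u a) = of fun u w =>
      (Fintype.card Ω : ℚ) * rootedLaplacian (transitionMatrix δ) r u w := by
    ext u w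
    rw [Finset.sum_apply, of_apply]
    rcases eq_or_ne u r with rfl | hu
    · simp [row, rootedLaplacian]
    · have hcard : (Fintype.card Ω : ℚ) ≠ 0 := by simp
      simp [row, rootedLaplacian, hu, transitionMatrix, mul_sub, mul_div_cancel₀ _ hcard,
        one_apply (i := δ u _)]
  have expand : det (fun u => ∑ a, row u a) = ∑ f : V → Ω, det fun u => row u (f u) :=
    MultilinearMap.map_sum (detRowAlternating (R := ℚ) (n := V)).toMultilinearMap row
  simp only [row_eq] at expand
  rw [← expand, sum_row, det_mul_column, Finset.prod_const, Finset.card_univ]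

theorem card_mul_card_isTreeToward [Nonempty Ω] (hreg : IsRegular δ) {n : ℕ}
    (hdef : IsDefinite δ n) (r : V) :
    Fintype.card V * Nat.card {f : V → Ω // IsTreeToward (fun u => δ u (f u)) r} =
      Fintype.card Ω ^ Fintype.card V := by
  classical
  have hsum := sum_det_rootedLaplacian δ r
  simp only [det_rootedLaplacian_submatrix_one, Finset.sum_boole] at hsum
  have hcard : (Nat.card {f : V → Ω // IsTreeToward (fun u => δ u (f u)) r} : ℚ) =
      Fintype.card Ω ^ Fintype.card V * (rootedLaplacian (transitionMatrix δ) r).det := by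
    rw [← hsum, Nat.card_eq_fintype_card, Fintype.card_subtype]
  have hq : (Fintype.card V * Nat.card {f : V → Ω // IsTreeToward (fun u => δ u (f u)) r} : ℚ) =
      Fintype.card Ω ^ Fintype.card V := by
    rw [hcard, mul_left_comm, card_mul_det_rootedLaplacian_transitionMatrix hreg hdef r, mul_one]
  exact_mod_cast hq

end TreeCount

section BalancedWords

variable {V Ω : Type*} [Fintype V] [DecidableEq V] [Fintype Ω] [DecidableEq Ω] {δ : V → Ω → V}
  {m : ℕ}

theorem inflow_eq_of_mem_equidistributedWords (hreg : IsRegular δ) {τ : V → List Ω}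
    (hτ : ∀ u, τ u ∈ equidistributedWords Ω m) (u : V) : inflow δ τ u = m * Fintype.card Ω := by
  simp only [inflow, fun w => countP_of_mem_equidistributedWords (δ w · = u) (hτ w),
    ← Finset.mul_sum, ← hreg u, Finset.card_filter, Fintype.sum_prod_type]

theorem isBalanced_iff_of_mem_equidistributedWords (hreg : IsRegular δ) {τ : V → List Ω}
    (hτ : ∀ u, τ u ∈ equidistributedWords Ω m) {v e : V} : IsBalanced δ τ v e ↔ v = e := by
  have isBalanced_iff : IsBalanced δ τ v e ↔ ∀ u, u = v ↔ u = e := forall_congr' fun u => by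
    rw [inflow_eq_of_mem_equidistributedWords hreg hτ, length_eq_of_mem_equidistributedWords (hτ u)]
    split_ifs <;> simp_all
  rw [isBalanced_iff]
  exact ⟨fun h => (h v).1 rfl, fun h u => by rw [h]⟩

omit [Fintype V] [DecidableEq V] [Fintype Ω] in
theorem isDirectedTo_iff_isTreeToward [Nonempty Ω] (hm : 1 ≤ m)
    (τ : V → equidistributedWords Ω m) (r : V) :
    IsDirectedTo δ (fun u => τ u) r ↔ IsTreeToward (fun u => δ u (lastLetter hm (τ u))) r := by
  have hne : ∀ u, (τ u : List Ω) ≠ [] := fun u => ne_nil_of_mem_equidistributedWords hm (τ u).2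
  have lastExit_eq : LastExit δ (fun u => τ u) = fun u w => δ u (lastLetter hm (τ u)) = w := by
    ext u w
    simp [LastExit, lastLetter, List.getLast?_eq_some_getLast (hne u)]
  rw [IsDirectedTo, IsTreeToward, lastExit_eq]
  exact forall_congr' fun u => imp_iff_right (hne u)

variable (δ m) in
/-- The words that use each transition of `δ` exactly `m` times when read from the state `r`. -/
def balancedWords (r : V) : Set (List Ω) :=
  {s | ∀ u, exitStacks δ r s u ∈ equidistributedWords Ω m}

omit [Fintype V] [Fintype Ω] in
theorem ne_nil_of_mem_balancedWords [Nonempty Ω] (hm : 1 ≤ m) {r : V} {s : List Ω}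
    (hs : s ∈ balancedWords δ m r) : s ≠ [] := by
  rintro rfl
  exact ne_nil_of_mem_equidistributedWords hm (hs r) rfl

theorem foldl_eq_of_mem_balancedWords (hreg : IsRegular δ) {r : V} {s : List Ω}
    (hs : s ∈ balancedWords δ m r) : s.foldl δ r = r :=
  ((isBalanced_iff_of_mem_equidistributedWords hreg hs).1
    (exists_exitStacks_eq_iff.1 ⟨s, rfl, rfl⟩).1).symm

theorem ncard_balancedWords_eq_card_isTreeToward [Nonempty Ω] (hreg : IsRegular δ) (hm : 1 ≤ m)
    (r : V) : (balancedWords δ m r).ncard =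
      Nat.card {τ : V → equidistributedWords Ω m //
        IsTreeToward (fun u => δ u (lastLetter hm (τ u))) r} := by
  refine Nat.card_eq_of_bijective (fun s => ⟨fun u => ⟨exitStacks δ r s u, s.2 u⟩, ?_⟩) ⟨?_, ?_⟩
  · rw [← isDirectedTo_iff_isTreeToward]
    exact (exists_exitStacks_eq_iff.1
      ⟨s.1, rfl, foldl_eq_of_mem_balancedWords hreg s.2⟩).2
  · intro s t h
    refine Subtype.ext (exitStacks_injective δ r (funext fun u => ?_))
    exact congrArg Subtype.val (congrFun (congrArg Subtype.val h) u)
  · rintro ⟨τ, hτ⟩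
    obtain ⟨s, hs, -⟩ := exists_exitStacks_eq_iff.2
      ⟨(isBalanced_iff_of_mem_equidistributedWords hreg fun u => (τ u).2).2 rfl,
        (isDirectedTo_iff_isTreeToward hm τ r).2 hτ⟩
    have hs' : ∀ u, exitStacks δ r s u = τ u := congrFun hs
    exact ⟨⟨s, fun u => hs' u ▸ (τ u).2⟩, Subtype.ext (funext fun u => Subtype.ext (hs' u))⟩

theorem card_mul_ncard_balancedWords [Nonempty Ω] (hreg : IsRegular δ) {n : ℕ}
    (hdef : IsDefinite δ n) (hm : 1 ≤ m) (r : V) :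
    Fintype.card V * (balancedWords δ m r).ncard =
      (equidistributedWords Ω m).ncard ^ Fintype.card V := by
  have := Fintype.ofFinite (equidistributedWords Ω m)
  have card_fiber : ∀ a, (Finset.univ.filter fun l => lastLetter hm l = a).card =
      Nat.card {l // lastLetter hm l = Classical.arbitrary Ω} := fun a => by
    rw [card_lastLetter_eq hm _ a, Nat.card_eq_fintype_card, Fintype.card_subtype]
  rw [ncard_balancedWords_eq_card_isTreeToward hreg hm, ← Nat.card_coe_set_eq,
    Nat.card_eq_fintype_card (α := equidistributedWords Ω m)]
  exact card_mul_card_isTreeToward (hreg.comp card_fiber) (hdef.comp (lastLetter hm)) r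

end BalancedWords

section Shift

variable {Ω : Type*} {n : ℕ}

/-- The de Bruijn automaton, whose state is the `n`-mer that has been read last. -/
def shift (u : Fin n → Ω) (a : Ω) : Fin n → Ω :=
  Fin.tail (Fin.snoc u a : Fin (n + 1) → Ω)

theorem foldl_shift_apply_eq (s : List Ω) {i : ℕ} {u u' : Fin n → Ω}
    (h : ∀ j : Fin n, i ≤ j → u j = u' j) {j : Fin n} (hj : i ≤ j + s.length) :
    s.foldl shift u j = s.foldl shift u' j := by
  induction s generalizing i u u' with
  | nil => exact h j hj
  | cons a s ih =>
    refine ih (i := i - 1) (fun l hl => ?_) (by rw [List.length_cons] at hj; omega)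
    by_cases hln : l.val + 1 < n
    · have hl' := h ⟨l + 1, hln⟩ (Nat.sub_le_iff_le_add.1 hl)
      simpa [shift, Fin.tail, Fin.snoc, hln, Fin.castLT] using hl'
    · simp [shift, Fin.tail, Fin.snoc, hln]

theorem isDefinite_shift : IsDefinite (shift (Ω := Ω) (n := n)) n := fun s hs _ _ =>
  funext fun j => foldl_shift_apply_eq s (fun l hl => absurd l.isLt hl.not_gt) (hs.trans (by omega))

theorem isRegular_shift [Fintype Ω] [DecidableEq Ω] : IsRegular (shift (Ω := Ω) (n := n)) := by
  intro w
  let e : (Fin n → Ω) × Ω ≃ Ω × (Fin n → Ω) :=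
    (Equiv.prodComm _ _).trans ((Fin.snocEquiv fun _ => Ω).trans (Fin.consEquiv fun _ => Ω).symm)
  have card_eq : (Finset.univ.filter fun p : (Fin n → Ω) × Ω => shift p.1 p.2 = w).card =
      ((Finset.univ : Finset Ω) ×ˢ {w}).card :=
    Finset.card_equiv e fun p => by
      simp only [Finset.mem_filter_univ, Finset.mem_product, Finset.mem_univ, true_and,
        Finset.mem_singleton]
      rfl
  rw [card_eq, Finset.card_product, Finset.card_singleton, mul_one, Finset.card_univ]

theorem snoc_cyclicKmer (t : List Ω) (n : ℕ) (i : Fin t.length) :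
    (Fin.snoc (cyclicKmer t n i) (t[(i + n) % t.length]'(Nat.mod_lt _ i.pos)) : Fin (n + 1) → Ω) =
      cyclicKmer t (n + 1) i := by
  funext j
  refine Fin.lastCases ?_ (fun j => ?_) j
  · simp [cyclicKmer]
  · simp [cyclicKmer]

theorem shift_cyclicKmer (t : List Ω) (n : ℕ) (i : Fin t.length) :
    shift (cyclicKmer t n i) (t[(i + n) % t.length]'(Nat.mod_lt _ i.pos)) =
      cyclicKmer t n ⟨(i + 1) % t.length, Nat.mod_lt _ i.pos⟩ := by
  funext j
  simp [shift, snoc_cyclicKmer, Fin.tail, cyclicKmer, add_assoc, add_comm 1]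

theorem foldl_shift_cyclicKmer {t : List Ω} (ht : 0 < t.length) (n : ℕ) {i : ℕ}
    (hi : i ≤ t.length) :
    ((t.rotate n).take i).foldl shift (cyclicKmer t n ⟨0, ht⟩) =
      cyclicKmer t n ⟨i % t.length, Nat.mod_lt _ ht⟩ := by
  induction i with
  | zero => simp
  | succ i ih =>
    have hlen : i < (t.rotate n).length := by rwa [List.length_rotate]
    have hmod : i % t.length = i := Nat.mod_eq_of_lt hi
    rw [List.take_succ_eq_append_getElem hlen, List.foldl_append, ih (Nat.le_of_succ_le hi)]
    simpa [hmod, List.getElem_rotate] using shift_cyclicKmer t n ⟨i, hi⟩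

theorem count_exitStacks_shift [DecidableEq Ω] {t : List Ω} (ht : 0 < t.length) (u : Fin n → Ω)
    (a : Ω) :
    (exitStacks shift (cyclicKmer t n ⟨0, ht⟩) (t.rotate n) u).count a =
      listCount (Fin.snoc u a : Fin (n + 1) → Ω) t := by
  rw [count_exitStacks, listCount]
  refine Finset.card_equiv (finCongr (List.length_rotate ..)) fun i => ?_
  have hi : i.val < t.length := i.isLt.trans_eq (List.length_rotate ..)
  have hcast : finCongr (List.length_rotate ..) i = ⟨i, hi⟩ := rfl
  simp only [Finset.mem_filter_univ, hcast, ← snoc_cyclicKmer, Fin.snoc_inj,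
    foldl_shift_cyclicKmer ht n hi.le, Nat.mod_eq_of_lt hi, List.getElem_rotate]

/-- The cyclic windows of `s` are the transitions of the run that starts from the window just
before the first letter, so this run is closed. -/
theorem exists_foldl_shift_eq_and_count_exitStacks_eq [DecidableEq Ω] (n : ℕ) {s : List Ω}
    (hs : s ≠ []) :
    ∃ r : Fin n → Ω, s.foldl shift r = r ∧ ∀ u a,
      (exitStacks shift r s u).count a = listCount (Fin.snoc u a : Fin (n + 1) → Ω) s := by
  obtain ⟨t, rfl⟩ : ∃ t : List Ω, t.rotate n = s := ⟨_, List.rotate_eq_iff.2 rfl⟩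
  have ht : 0 < t.length := by simpa [List.length_pos_iff] using hs
  refine ⟨cyclicKmer t n ⟨0, ht⟩, ?_, fun u a => ?_⟩
  · have h := foldl_shift_cyclicKmer ht n le_rfl
    rw [List.take_of_length_le (List.length_rotate ..).le] at h
    simpa using h
  · rw [count_exitStacks_shift ht, listCount_eq_of_isRotated _ ⟨n, rfl⟩]

end Shift

section Rotations

theorem sum_card_filter_rotate {α : Type*} {L : Finset (List α)}
    (hL : ∀ t ∈ L, ∀ i, t.rotate i ∈ L) (p : List α → Prop) [DecidablePred p] (N : ℕ) :
    ∑ t ∈ L, ((Finset.range N).filter fun i => p (t.rotate i)).card =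
      N * (L.filter p).card := by
  have card_filter_rotate : ∀ i, (L.filter fun t => p (t.rotate i)).card = (L.filter p).card :=
    fun i => Finset.card_bij (fun t _ => t.rotate i)
      (fun t ht => by
        rw [Finset.mem_filter] at ht ⊢
        exact ⟨hL t ht.1 i, ht.2⟩)
      (fun _ _ _ _ h => List.rotate_injective i h)
      fun s hs => by
        have hs' : (s.rotate (s.length - i % s.length)).rotate i = s := List.rotate_eq_iff.2 rfl
        rw [Finset.mem_filter] at hs
        exact ⟨_, Finset.mem_filter.2 ⟨hL s hs.1 _, by rw [hs']; exact hs.2⟩, hs'⟩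
  have h := Finset.sum_card_bipartiteAbove_eq_sum_card_bipartiteBelow (s := L)
    (t := Finset.range N) fun t i => p (t.rotate i)
  simpa only [Finset.bipartiteAbove, Finset.bipartiteBelow, card_filter_rotate, Finset.sum_const,
    Finset.card_range, smul_eq_mul] using h

end Rotations

section LinearizedSeqs

variable {Ω : Type*} [DecidableEq Ω] {m k : ℕ}

theorem mem_linearizedSeqs_iff {s : List Ω} :
    s ∈ linearizedSeqs Ω m k ↔ ∀ y : Fin k → Ω, listCount y s = m :=
  ⟨by rintro ⟨_, hc, rfl⟩; exact hc, fun h => ⟨s, h, rfl⟩⟩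

theorem rotate_mem_linearizedSeqs {t : List Ω} (ht : t ∈ linearizedSeqs Ω m k) (i : ℕ) :
    t.rotate i ∈ linearizedSeqs Ω m k := by
  rw [mem_linearizedSeqs_iff] at ht ⊢
  exact fun y => (listCount_eq_of_isRotated y (List.IsRotated.forall t i)).trans (ht y)

omit [DecidableEq Ω] in
theorem startsWith_rotate_iff {t : List Ω} (i : Fin t.length) (y : Fin k → Ω) :
    StartsWith (t.rotate i) y ↔ cyclicKmer t k i = y := by
  have hpos : 0 < (t.rotate i).length := by rw [List.length_rotate]; exact i.pos
  have kmer_eq : cyclicKmer (t.rotate i) k ⟨0, hpos⟩ = cyclicKmer t k i := by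
    funext j
    simp [cyclicKmer, List.getElem_rotate, add_comm]
  rw [StartsWith, exists_prop_of_true hpos, kmer_eq]

theorem listCount_eq_card_startsWith_rotate (y : Fin k → Ω)
    [DecidablePred fun s : List Ω => StartsWith s y] (t : List Ω) :
    listCount y t =
      ((Finset.range t.length).filter fun i => StartsWith (t.rotate i) y).card := by
  rw [listCount, Finset.card_filter, Finset.card_filter, ← Fin.sum_univ_eq_sum_range]
  simp only [startsWith_rotate_iff]

variable [Fintype Ω]

theorem sum_listCount (k : ℕ) (s : List Ω) : ∑ y : Fin k → Ω, listCount y s = s.length := by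
  have h := Finset.card_eq_sum_card_fiberwise (f := cyclicKmer s k) (s := Finset.univ)
    (t := Finset.univ) fun _ _ => Finset.mem_coe.2 (Finset.mem_univ _)
  rw [Finset.card_univ, Fintype.card_fin] at h
  exact h.symm

theorem length_eq_of_mem_linearizedSeqs {s : List Ω} (hs : s ∈ linearizedSeqs Ω m k) :
    s.length = Fintype.card Ω ^ k * m := by
  simp [← sum_listCount k s, mem_linearizedSeqs_iff.1 hs]

omit [Fintype Ω] in
theorem finite_linearizedSeqs [Finite Ω] (m k : ℕ) : (linearizedSeqs Ω m k).Finite := by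
  have := Fintype.ofFinite Ω
  exact (List.finite_length_eq Ω _).subset fun _ => length_eq_of_mem_linearizedSeqs

theorem card_pow_mul_ncard_linearizedSeqsFrom (hm : 1 ≤ m) (y : Fin k → Ω) :
    Fintype.card Ω ^ k * (linearizedSeqsFrom m k y).ncard = (linearizedSeqs Ω m k).ncard := by
  classical
  let L := (finite_linearizedSeqs (Ω := Ω) m k).toFinset
  have mem_L {t : List Ω} : t ∈ L ↔ t ∈ linearizedSeqs Ω m k := Set.Finite.mem_toFinset _
  have card_L : (linearizedSeqs Ω m k).ncard = L.card := Set.ncard_eq_toFinset_card _ _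
  have card_filter_L : (linearizedSeqsFrom m k y).ncard =
      (L.filter fun t => StartsWith t y).card := by
    rw [← Set.ncard_coe_finset]
    congr 1
    ext t
    simp [linearizedSeqsFrom, mem_L]
  have card_filter_rotate : ∀ t ∈ L, ((Finset.range (Fintype.card Ω ^ k * m)).filter fun i =>
      StartsWith (t.rotate i) y).card = m := fun t ht => by
    rw [← length_eq_of_mem_linearizedSeqs (mem_L.1 ht)]
    exact (listCount_eq_card_startsWith_rotate y t).symm.trans
      (mem_linearizedSeqs_iff.1 (mem_L.1 ht) y)
  have double_count := sum_card_filter_rotate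
    (fun t ht i => mem_L.2 (rotate_mem_linearizedSeqs (mem_L.1 ht) i)) (fun t => StartsWith t y)
    (Fintype.card Ω ^ k * m)
  rw [Finset.sum_congr rfl card_filter_rotate, Finset.sum_const, smul_eq_mul, ← card_filter_L,
    ← card_L, mul_right_comm] at double_count
  exact (Nat.eq_of_mul_eq_mul_right hm double_count).symm

end LinearizedSeqs

section BalancedShiftWords

variable {Ω : Type*} [Fintype Ω] [DecidableEq Ω] [Nonempty Ω] {m n : ℕ}

omit [Fintype Ω] in
theorem mem_linearizedSeqs_iff_exists_mem_balancedWords [Finite Ω] (hm : 1 ≤ m) {s : List Ω} :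
    s ∈ linearizedSeqs Ω m (n + 1) ↔ ∃ r : Fin n → Ω, s ∈ balancedWords shift m r := by
  have := Fintype.ofFinite Ω
  constructor
  · intro h
    rw [mem_linearizedSeqs_iff] at h
    have hs : s ≠ [] := by
      rintro rfl
      have := h fun _ => Classical.arbitrary Ω
      simp [listCount] at this
      omega
    obtain ⟨r, -, hr⟩ := exists_foldl_shift_eq_and_count_exitStacks_eq n hs
    exact ⟨r, fun u a => (hr u a).trans (h _)⟩
  · rintro ⟨r, h⟩
    have hs : s ≠ [] := ne_nil_of_mem_balancedWords hm h
    obtain ⟨r', hclosed, hr'⟩ := exists_foldl_shift_eq_and_count_exitStacks_eq n hs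
    obtain rfl : r = r' :=
      isDefinite_shift.eq_of_foldl_eq hs (foldl_eq_of_mem_balancedWords isRegular_shift h) hclosed
    refine mem_linearizedSeqs_iff.2 fun y => ?_
    rw [← Fin.snoc_init_self y, ← hr']
    exact h _ _

theorem ncard_linearizedSeqs_succ (hm : 1 ≤ m) (n : ℕ) :
    (linearizedSeqs Ω m (n + 1)).ncard =
      (equidistributedWords Ω m).ncard ^ Fintype.card Ω ^ n := by
  have linearizedSeqs_eq : linearizedSeqs Ω m (n + 1) =
      ⋃ r : Fin n → Ω, balancedWords shift m r := by
    ext s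
    rw [mem_linearizedSeqs_iff_exists_mem_balancedWords hm, Set.mem_iUnion]
  have finite_balancedWords (r : Fin n → Ω) : (balancedWords shift m r).Finite :=
    (finite_linearizedSeqs m (n + 1)).subset
      (linearizedSeqs_eq ▸ Set.subset_iUnion (balancedWords shift m) r)
  have pairwise_disjoint :
      Pairwise (Function.onFun Disjoint fun r : Fin n → Ω => balancedWords shift m r) := by
    refine fun r r' hrr' => Set.disjoint_left.2 fun s hr hr' => hrr' ?_
    exact isDefinite_shift.eq_of_foldl_eq (ne_nil_of_mem_balancedWords hm hr)
      (foldl_eq_of_mem_balancedWords isRegular_shift hr)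
      (foldl_eq_of_mem_balancedWords isRegular_shift hr')
  have ncard_balancedWords (r : Fin n → Ω) :=
    card_mul_ncard_balancedWords isRegular_shift isDefinite_shift hm r
  have ncard_eq (r : Fin n → Ω) : (balancedWords shift m r).ncard =
      (balancedWords shift m fun _ => Classical.arbitrary Ω).ncard :=
    Nat.eq_of_mul_eq_mul_left Fintype.card_pos
      ((ncard_balancedWords r).trans (ncard_balancedWords _).symm)
  rw [linearizedSeqs_eq, Set.ncard_iUnion_of_finite finite_balancedWords pairwise_disjoint,
    finsum_eq_sum_of_fintype, Finset.sum_congr rfl fun r _ => ncard_eq r, Finset.sum_const,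
    smul_eq_mul, Finset.card_univ, ncard_balancedWords, Fintype.card_fun, Fintype.card_fin]

end BalancedShiftWords

end MultiDeBruijn

theorem mainTheorem2 {Ω : Type*} [Fintype Ω] [DecidableEq Ω] (m q k : ℕ)
    (hΩ : Fintype.card Ω = q) (hm : 1 ≤ m) (hk : 1 ≤ k) (y : Fin k → Ω) :
    (MultiDeBruijn.linearizedSeqsFrom m k y).Finite ∧
      ((MultiDeBruijn.linearizedSeqsFrom m k y).ncard : ℚ)
        = MultiDeBruijn.W m q k / (q : ℚ) ^ k := by
  refine ⟨(MultiDeBruijn.finite_linearizedSeqs m k).subset fun s hs => hs.1, ?_⟩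
  obtain ⟨n, rfl⟩ := Nat.exists_eq_add_of_le' hk
  have : Nonempty Ω := ⟨y 0⟩
  subst hΩ
  have hq : (Fintype.card Ω : ℚ) ≠ 0 := by exact_mod_cast Fintype.card_ne_zero
  have card_words : ((MultiDeBruijn.equidistributedWords Ω m).ncard : ℚ) =
      (m * Fintype.card Ω).factorial / m.factorial ^ Fintype.card Ω := by
    rw [eq_div_iff (by positivity)]
    exact_mod_cast MultiDeBruijn.ncard_equidistributedWords_mul_factorial_pow m
  have card_seqs := MultiDeBruijn.card_pow_mul_ncard_linearizedSeqsFrom hm y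
  rw [MultiDeBruijn.ncard_linearizedSeqs_succ hm n] at card_seqs
  rw [eq_div_iff (pow_ne_zero _ hq), MultiDeBruijn.W, Nat.add_sub_cancel, ← card_words, mul_comm]
  exact_mod_cast card_seqs
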